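/- Let $\beta\in\mathbb R\setminus\{0\}$, $d\ge 0$, and consider one of the following two settings. (a) Euclidean: $X,Y\subset\mathbb R^d$ are compact, $\langle x,y\rangle$ is the Euclidean inner product, and $T_f(y)=\nabla f^\star(y)$. (b) Torus: $X=Y=\mathbb R^d/\mathbb Z^d$, $\langle x,y\rangle:=-d(x,y)^2$ with $d(\cdot,\cdot)$ the flat distance, and $T_f(y)=y+\tfrac12\nabla f^\star(y)$ modulo $\mathbb Z^d$. Here $f^\star(y)=\sup_{x\in X}[\langle x,y\rangle-f(x)]$ for $f\in C(X)$ (in (a), for all $y\in\mathbb R^d$). Let $\mu_0$ be a Borel probability measure on $X$ with full support ($\mu_0(U)>0$ for every nonempty relatively open $U\subset X$), and let $\nu$ be a Borel probability measure on $Y$ that is absolutely continuous with respect to Lebesgue measure. Put $J_\nu(f)=\int_Y f^\star\,d\nu$, $\mathrm{MA}_\nu f=(T_f)_\#\nu$ ($T_f$ is defined $\nu$-almost everywhere), and $$F_{\beta,\mu_0,\nu}(\theta)=\frac1\beta\log\int_X e^{\beta\theta}\,d\mu_0+J_\nu(\theta),\qquad \theta\in C(X).$$ For Borel probability measures $\mu$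 on $X$ put $$W_2^2(\mu,\nu)=\inf_{\gamma\in\Pi(\mu,\nu)}\int_{X\times Y}-\langle x,y\rangle\,d\gamma(x,y),$$ where $\Pi(\mu,\nu)$ is the set of measures on $X\times Y$ with marginals $\mu$ and $\nu$; let $\mathrm{Ent}(\mu_0,\mu)=\int_X\log\frac{d\mu}{d\mu_0}\,d\mu$ if $\mu\ll\mu_0$ and $\mathrm{Ent}(\mu_0,\mu)=\infty$ otherwise; and put $$G_{\beta,\mu_0,\nu}(\mu)=\beta W_2^2(\mu,\nu)+\mathrm{Ent}(\mu_0,\mu)+C,$$ where the constant $C$ is chosen so that $\inf G_{\beta,\mu_0,\nu}=0$. Then $F_{\beta,\mu_0,\nu}$ has a minimizer in $C(X)$ that is unique up to additive constants if and only if $G_{\beta,\mu_0,\nu}$ has a unique minimizer among the Borel probability measures on $X$. In that case, if $\phi_{\min}$ is a minimizer of $F_{\beta,\mu_0,\nu}$, the minimizer of $G_{\beta,\mu_0,\nu}$ is $\mathrm{MA}_\nu\phi_{\min}$, and $\phi_{\min}$ solves the Monge–Ampère equation $$\mathrm{MA}_\nu\phi_{\min}=\frac{e^{\beta\phi_{\min}}\mu_0}{\int_X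 e^{\beta\phi_{\min}}\,d\mu_0}.$$ -/

import Mathlib

open MeasureTheory Set

noncomputable section

namespace MAGibbs

/-! ### Functionals attached to a pairing `p : X → Y → ℝ` (`p x y` plays the role of `⟨x, y⟩`) -/

/-- The Legendre transform `f⋆(y) = sup_x [⟨x, y⟩ - f(x)]` of a continuous function on `X`.
(For `X` compact and nonempty and `p` continuous in `x` this is a supremum of a nonempty bounded
set.) -/
def legendre {X Y : Type*} [TopologicalSpace X]
    (p : X → Y → ℝ) (f : C(X, ℝ)) (y : Y) : ℝ :=
  ⨆ x : X, (p x y - f x)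

/-- `J_ν(f) = ∫ f⋆ dν`. -/
def J {X Y : Type*} [TopologicalSpace X] [MeasurableSpace Y]
    (p : X → Y → ℝ) (ν : Measure Y) (f : C(X, ℝ)) : ℝ :=
  ∫ y, legendre p f y ∂ν

/-- `I_{μ₀}(θ) = log ∫ e^θ dμ₀`. -/
def logMGF {X : Type*} [TopologicalSpace X] [MeasurableSpace X]
    (μ₀ : Measure X) (θ : C(X, ℝ)) : ℝ :=
  Real.log (∫ x, Real.exp (θ x) ∂μ₀)

/-- `F_{β,μ₀,ν}(θ) = (1/β) I_{μ₀}(β θ) + J_ν(θ)`. -/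
def F {X Y : Type*} [TopologicalSpace X] [MeasurableSpace X] [MeasurableSpace Y]
    (p : X → Y → ℝ) (β : ℝ) (μ₀ : Measure X) (ν : Measure Y) (θ : C(X, ℝ)) : ℝ :=
  1 / β * logMGF μ₀ (β • θ) + J p ν θ

/-- Transport plans: measures on `X × Y` with marginals `μ` and `ν`. -/
def plans {X Y : Type*} [MeasurableSpace X] [MeasurableSpace Y]
    (μ : Measure X) (ν : Measure Y) : Set (Measure (X × Y)) :=
  {γ | γ.fst = μ ∧ γ.snd = ν}

/-- The optimal transport cost `W₂²(μ, ν) = inf_γ ∫ c dγ` for the cost `c(x, y) = -⟨x, y⟩`. -/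
def W22 {X Y : Type*} [MeasurableSpace X] [MeasurableSpace Y]
    (p : X → Y → ℝ) (μ : Measure X) (ν : Measure Y) : ℝ :=
  sInf ((fun γ : Measure (X × Y) => ∫ z, -p z.1 z.2 ∂γ) '' plans μ ν)

/-- `β W₂²(μ, ν) + Ent(μ₀, μ)`, where `Ent(μ₀, μ) = ∫ log (dμ/dμ₀) dμ` if `μ ≪ μ₀` and `∞`
otherwise (this is the Kullback-Leibler divergence `klDiv μ μ₀`). -/
def freeEnergy {X Y : Type*} [MeasurableSpace X] [MeasurableSpace Y]
    (p : X → Y → ℝ) (β : ℝ) (μ₀ : Measure X) (ν : Measure Y)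
    (μ : ProbabilityMeasure X) : EReal :=
  ((β * W22 p (μ : Measure X) ν : ℝ) : EReal)
    + (InformationTheory.klDiv (μ : Measure X) μ₀ : EReal)

/-- The constant `C` that makes the infimum of `G` equal to zero. -/
def normConst {X Y : Type*} [MeasurableSpace X] [MeasurableSpace Y]
    (p : X → Y → ℝ) (β : ℝ) (μ₀ : Measure X) (ν : Measure Y) : ℝ :=
  -(⨅ μ : ProbabilityMeasure X, freeEnergy p β μ₀ ν μ).toReal

/-- `G_{β,μ₀,ν} = β W₂²(·, ν) + Ent(μ₀, ·) + C` on probability measures on `X`. -/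
def G {X Y : Type*} [MeasurableSpace X] [MeasurableSpace Y]
    (p : X → Y → ℝ) (β : ℝ) (μ₀ : Measure X) (ν : Measure Y)
    (μ : ProbabilityMeasure X) : EReal :=
  freeEnergy p β μ₀ ν μ + (normConst p β μ₀ ν : EReal)

/-- `a` is a (global) minimizer of `Φ`. -/
def IsMinimizer {A B : Type*} [LE B] (Φ : A → B) (a : A) : Prop :=
  ∀ b, Φ a ≤ Φ b

/-- `φ` is a minimizer of `Φ`, and every minimizer is of the form `φ + c` with `c` constant. -/
def IsUniqueMinimizerModConst {X : Type*} [TopologicalSpace X] (Φ : C(X, ℝ) → ℝ)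
    (φ : C(X, ℝ)) : Prop :=
  IsMinimizer Φ φ ∧ ∀ ψ, IsMinimizer Φ ψ → ∃ c : ℝ, ∀ x, ψ x = φ x + c

/-! ### The Euclidean setting -/

/-- The pairing `⟨x, y⟩` between a subset `X` of `ℝᵈ` and `ℝᵈ`. -/
def euclPairing {d : ℕ} (X : Set (EuclideanSpace ℝ (Fin d))) (x : X)
    (y : EuclideanSpace ℝ (Fin d)) : ℝ :=
  inner ℝ (x : EuclideanSpace ℝ (Fin d)) y

/-- The Monge-Ampère operator `MA_ν f = (∇ f⋆)_# ν`, as a measure on `ℝᵈ`. -/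
def euclMA {d : ℕ} (X : Set (EuclideanSpace ℝ (Fin d)))
    (ν : Measure (EuclideanSpace ℝ (Fin d))) (f : C(X, ℝ)) :
    Measure (EuclideanSpace ℝ (Fin d)) :=
  ν.map (fun y => gradient (legendre (euclPairing X) f) y)

/-! ### The setting of the torus `ℝᵈ / ℤᵈ` -/

/-- The torus `ℝᵈ / ℤᵈ`. -/
abbrev Torus (d : ℕ) : Type := Fin d → UnitAddCircle

/-- The projection `ℝᵈ → ℝᵈ / ℤᵈ`. -/
def torusProj {d : ℕ} (v : EuclideanSpace ℝ (Fin d)) : Torus d :=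
  fun i => ((v i : ℝ) : UnitAddCircle)

/-- The pairing `-d(x, y)²`, with `d` the flat distance on the torus: the norm on `ℝ / ℤ` is the
distance to the nearest integer, so `d(x, y)² = ∑ᵢ ‖xᵢ - yᵢ‖² = inf_{m ∈ ℤᵈ} |x - y - m|²`. -/
def torusPairing {d : ℕ} (x y : Torus d) : ℝ :=
  -∑ i, ‖x i - y i‖ ^ 2

/-- The gradient at `y` of a function on the torus, for the flat metric. -/
def torusGradient {d : ℕ} (u : Torus d → ℝ) (y : Torus d) : EuclideanSpace ℝ (Fin d) :=
  gradient (fun v : EuclideanSpace ℝ (Fin d) => u (y + torusProj v)) 0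

/-- The Monge-Ampère operator on the torus: the push-forward of `ν` under the transport map
`y ↦ exp_y (½ ∇ f⋆(y))` that `f⋆` induces for the cost `d²`. -/
def torusMA {d : ℕ} (ν : Measure (Torus d)) (f : C(Torus d, ℝ)) : Measure (Torus d) :=
  ν.map (fun y => y + torusProj ((1 / 2 : ℝ) • torusGradient (legendre torusPairing f) y))

end MAGibbs

end

/-! Everything rests on one identity (`freeEnergy_eq`): for every potential `θ` and every
probability measure `μ`, the free energy of `μ` equals `-β F(θ)`, plus `β` times the duality gap
`W22(μ, ν) + ∫ θ dμ + J(θ)`, plus the relative entropy of `μ` with respect to the Gibbs measure of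
`θ`. The entropy term is nonnegative, and so is the gap, by weak Kantorovich duality.

If `θ` minimizes `F`, the Euler-Lagrange equation says that its Gibbs measure is `T_#ν`, where `T y`
is the a.e. unique maximizer in the Legendre transform. The graph of `T` is then an optimal plan, so
the gap vanishes and the free energy is `-β min F` (`freeEnergy_gibbs`). This value is minimal: for
`β > 0` use the identity with a minimizer of `F`, for `β < 0` with a potential of zero gap for the
competitor. The equality cases show that the minimizers of `G` are exactly the Gibbs measures of
minimizers of `F` (`isMinimizer_gibbs`, `exists_eq_gibbs`). Since `μ₀` has full support and `β ≠ 0`,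
a Gibbs measure determines its potential up to a constant, so the two uniqueness statements agree.

Minimizers of `F` always exist, by double Legendre transforms and Arzelà-Ascoli
(`exists_isMinimizer_add_J`). The settings differ only in the proof of the twist condition, which
comes from Rademacher's theorem. -/

namespace MAGibbs

/-! ### Legendre transforms and the envelope theorem. -/

section Legendre

variable {X Y : Type*} [TopologicalSpace X] [CompactSpace X] [TopologicalSpace Y] {p : X → Y → ℝ}

lemma bddAbove_range_sub (hp : Continuous fun z : X × Y => p z.1 z.2) (f : C(X, ℝ)) (y : Y) :
    BddAbove (range fun x => p x y - f x) := by
  have h : Continuous fun x => p x y - f x :=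
    (hp.comp (by fun_prop : Continuous fun x : X => (x, y))).sub f.continuous
  exact (isCompact_range h).bddAbove

lemma sub_le_legendre (hp : Continuous fun z : X × Y => p z.1 z.2) (f : C(X, ℝ)) (x : X) (y : Y) :
    p x y - f x ≤ legendre p f y :=
  le_ciSup (bddAbove_range_sub hp f y) x

lemma continuous_legendre (hp : Continuous fun z : X × Y => p z.1 z.2) (f : C(X, ℝ)) :
    Continuous (legendre p f) := by
  have h : Continuous fun z : Y × X => p z.2 z.1 - f z.2 :=
    (hp.comp continuous_swap).sub (f.continuous.comp continuous_snd)
  have := isCompact_univ.continuous_sSup (f := fun (y : Y) (x : X) => p x y - f x) h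
  simp only [image_univ, sSup_range] at this
  exact this

variable [Nonempty X]

lemma exists_legendre_eq (hp : Continuous fun z : X × Y => p z.1 z.2) (f : C(X, ℝ)) (y : Y) :
    ∃ x, legendre p f y = p x y - f x := by
  have h : Continuous fun x => p x y - f x :=
    (hp.comp (by fun_prop : Continuous fun x : X => (x, y))).sub f.continuous
  obtain ⟨x, -, hx⟩ := isCompact_univ.exists_isMaxOn univ_nonempty h.continuousOn
  exact ⟨x, le_antisymm (ciSup_le fun z => hx (mem_univ z)) (sub_le_legendre hp f x y)⟩

lemma abs_legendre_sub_legendre_le (hp : Continuous fun z : X × Y => p z.1 z.2)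
    (f g : C(X, ℝ)) (y : Y) : |legendre p f y - legendre p g y| ≤ ‖f - g‖ := by
  have key (f g : C(X, ℝ)) : legendre p f y - legendre p g y ≤ ‖g - f‖ := by
    obtain ⟨x, hx⟩ := exists_legendre_eq hp f y
    have h₁ := sub_le_legendre hp g x y
    have h₂ := (le_abs_self _).trans ((g - f).norm_coe_le_norm x)
    simp only [ContinuousMap.sub_apply] at h₂
    linarith
  rw [abs_le]
  constructor
  · linarith [key g f]
  · simpa only [norm_sub_rev] using key f g

lemma legendre_add_const (f : C(X, ℝ)) (c : ℝ) (y : Y)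
    (hp : Continuous fun z : X × Y => p z.1 z.2) :
    legendre p (f + ContinuousMap.const X c) y = legendre p f y - c := by
  obtain ⟨x, hx⟩ := exists_legendre_eq hp f y
  obtain ⟨x', hx'⟩ := exists_legendre_eq hp (f + ContinuousMap.const X c) y
  have h₁ := sub_le_legendre hp f x' y
  have h₂ := sub_le_legendre hp (f + ContinuousMap.const X c) x y
  simp only [ContinuousMap.add_apply, ContinuousMap.const_apply] at *
  linarith

/-- Danskin's envelope theorem: maximizers of the perturbed problems converge to the unique
maximizer `x₀`, so only the explicit dependence on `t` contributes to the derivative. -/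
lemma hasDerivAt_legendre (hp : Continuous fun z : X × Y => p z.1 z.2) [T2Space X]
    (f v : C(X, ℝ)) (y : Y) (x₀ : X)
    (h₀ : ∀ x, legendre p f y = p x y - f x → x = x₀) :
    HasDerivAt (fun t : ℝ => legendre p (f + t • v) y) (-v x₀) 0 := by
  have hx₀ : legendre p f y = p x₀ y - f x₀ := by
    obtain ⟨x, hx⟩ := exists_legendre_eq hp f y
    rwa [← h₀ x hx]
  choose ξ hξ using fun t : ℝ => exists_legendre_eq hp (f + t • v) y
  have hcont : Continuous fun x => p x y - f x :=
    (hp.comp (by fun_prop : Continuous fun x : X => (x, y))).sub f.continuous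
  -- By compactness it is enough to identify cluster points. The unperturbed objective at `ξ t` is
  -- within `2|t|‖v‖` of its supremum, so each cluster point is a maximizer.
  have hlim : Filter.Tendsto ξ (nhds 0) (nhds x₀) := by
    apply tendsto_nhds_of_unique_mapClusterPt
    intro x hx
    apply h₀
    obtain ⟨U, hU, hξU⟩ := mapClusterPt_iff_ultrafilter.1 hx
    have h2 : Filter.Tendsto ((fun x => p x y - f x) ∘ ξ) (nhds 0) (nhds (legendre p f y)) := by
      rw [tendsto_iff_dist_tendsto_zero]
      apply squeeze_zero (g := fun t : ℝ => |t| * ‖v‖ + |t| * ‖v‖) (fun _ => dist_nonneg)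
      · intro t
        have e := hξ t
        have e1 := abs_legendre_sub_legendre_le hp (f + t • v) f y
        have e2 := (v.norm_coe_le_norm (ξ t))
        have e3 : |t * v (ξ t)| ≤ |t| * ‖v‖ := by
          rw [abs_mul]; exact mul_le_mul_of_nonneg_left e2 (abs_nonneg t)
        simp only [add_sub_cancel_left, norm_smul, Real.norm_eq_abs] at e1
        simp only [ContinuousMap.add_apply, ContinuousMap.smul_apply, smul_eq_mul] at e
        have e4 : p (ξ t) y - f (ξ t) - legendre p f y
            = (legendre p (f + t • v) y - legendre p f y) + t * v (ξ t) := by linarith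
        simp only [Function.comp, Real.dist_eq, e4]
        exact (abs_add_le _ _).trans (add_le_add e1 e3)
      · have : Continuous fun t : ℝ => |t| * ‖v‖ + |t| * ‖v‖ := by fun_prop
        simpa using this.tendsto 0
    exact tendsto_nhds_unique (h2.mono_left hU) ((hcont.tendsto x).comp hξU)
  rw [hasDerivAt_iff_isLittleO, Asymptotics.isLittleO_iff]
  intro c hc
  have hv := (v.continuous.tendsto x₀).comp hlim
  filter_upwards [hv (Metric.ball_mem_nhds _ hc)] with t ht
  simp only [mem_preimage, Function.comp, Metric.mem_ball, Real.dist_eq] at ht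
  have e := hξ t
  have e1 := sub_le_legendre hp f (ξ t) y
  have e2 := sub_le_legendre hp (f + t • v) x₀ y
  simp only [ContinuousMap.add_apply, ContinuousMap.smul_apply, smul_eq_mul] at e e2
  simp only [zero_smul, add_zero, sub_zero, smul_eq_mul, mul_neg, sub_neg_eq_add,
    Real.norm_eq_abs]
  -- Testing the perturbed supremum at `x₀` and the unperturbed one at `ξ t` squeezes the remainder
  -- between `0` and `-t (v (ξ t) - v x₀)`, which is `o(t)`.
  have l1 : 0 ≤ legendre p (f + t • v) y - legendre p f y + t * v x₀ := by linarith
  have l2 : legendre p (f + t • v) y - legendre p f y + t * v x₀ ≤ -(t * (v (ξ t) - v x₀)) := by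
    linarith
  rw [abs_of_nonneg l1]
  calc _ ≤ |t * (v (ξ t) - v x₀)| := l2.trans (neg_le_abs _)
    _ = |v (ξ t) - v x₀| * |t| := by rw [abs_mul, mul_comm]
    _ ≤ _ := mul_le_mul_of_nonneg_right ht.le (abs_nonneg t)

end Legendre

section Functional

variable {X Y : Type*} [TopologicalSpace X] [CompactSpace X]
  [TopologicalSpace Y] [MeasurableSpace Y] [OpensMeasurableSpace Y] {p : X → Y → ℝ}
  {ν : Measure Y} [IsProbabilityMeasure ν] {K : Set Y}

lemma _root_.Continuous.integrable_of_measure_compl_eq_zero {g : Y → ℝ} (hg : Continuous g)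
    (hK : IsCompact K) (hνK : ν Kᶜ = 0) : Integrable g ν := by
  obtain ⟨C, hC⟩ := hK.exists_bound_of_continuousOn hg.continuousOn
  refine Integrable.of_bound hg.measurable.aestronglyMeasurable C ?_
  filter_upwards [compl_mem_ae_iff.2 hνK] with y hy
  exact hC y (not_not.1 hy)

lemma integrable_legendre (hp : Continuous fun z : X × Y => p z.1 z.2) (hK : IsCompact K)
    (hνK : ν Kᶜ = 0) (f : C(X, ℝ)) : Integrable (legendre p f) ν :=
  (continuous_legendre hp f).integrable_of_measure_compl_eq_zero hK hνK

variable [Nonempty X]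

lemma J_add_const (hp : Continuous fun z : X × Y => p z.1 z.2) (hK : IsCompact K)
    (hνK : ν Kᶜ = 0) (f : C(X, ℝ)) (c : ℝ) :
    J p ν (f + ContinuousMap.const X c) = J p ν f - c := by
  simp only [J, legendre_add_const _ _ _ hp]
  rw [integral_sub (integrable_legendre hp hK hνK f) (integrable_const c)]
  simp

lemma continuous_J (hp : Continuous fun z : X × Y => p z.1 z.2) (hK : IsCompact K)
    (hνK : ν Kᶜ = 0) : Continuous (J p ν) := by
  apply LipschitzWith.continuous (K := 1)
  apply LipschitzWith.of_dist_le_mul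
  intro f g
  rw [NNReal.coe_one, one_mul, dist_eq_norm, dist_eq_norm, J, J,
    ← integral_sub (integrable_legendre hp hK hνK f) (integrable_legendre hp hK hνK g)]
  have := norm_integral_le_of_norm_le_const (μ := ν)
    (f := fun y => legendre p f y - legendre p g y)
    (Filter.Eventually.of_forall fun y => abs_legendre_sub_legendre_le hp f g y)
  simpa using this

lemma hasDerivAt_J [T2Space X] [MeasurableSpace X] [OpensMeasurableSpace X]
    (hp : Continuous fun z : X × Y => p z.1 z.2) (hK : IsCompact K) (hνK : ν Kᶜ = 0)
    (f v : C(X, ℝ)) {T : Y → X} (hT : Measurable T)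
    (h : ∀ᵐ y ∂ν, ∀ x, legendre p f y = p x y - f x → x = T y) :
    HasDerivAt (fun t : ℝ => J p ν (f + t • v)) (-∫ y, v (T y) ∂ν) 0 := by
  rw [← integral_neg]
  refine (hasDerivAt_integral_of_dominated_loc_of_lip (bound := fun _ => ‖v‖)
    (F := fun (t : ℝ) y => legendre p (f + t • v) y)
    Filter.univ_mem (Filter.Eventually.of_forall fun t =>
      (integrable_legendre hp hK hνK (f + t • v)).1) (integrable_legendre hp hK hνK _)
      ((v.continuous.measurable.comp hT).neg.aestronglyMeasurable)
      (Filter.Eventually.of_forall fun y => ?_) (integrable_const _) ?_).2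
  · apply LipschitzOnWith.of_dist_le_mul
    intro s _ t _
    rw [Real.dist_eq]
    refine (abs_legendre_sub_legendre_le hp _ _ y).trans ?_
    rw [add_sub_add_left_eq_sub, ← sub_smul, norm_smul, mul_comm, Real.dist_eq, Real.norm_eq_abs,
      Real.coe_nnabs, abs_norm]
  · filter_upwards [h] with y hy
    exact hasDerivAt_legendre hp f v y (T y) hy

end Functional

end MAGibbs

namespace MAGibbs

/-! ### Existence of minimizers by compactness. -/

section Existence

variable {X Y : Type*} [TopologicalSpace X] [TopologicalSpace Y] {p : X → Y → ℝ}

/-- The restriction of the pairing to a subset `K` of `Y`, as a continuous family of functions. -/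
def pairingOn (hp : Continuous fun z : X × Y => p z.1 z.2) (K : Set Y) : C(X, C(K, ℝ)) :=
  ContinuousMap.curry ⟨fun z : X × K => p z.1 z.2, by fun_prop⟩

/-- The functions vanishing at `x₀` that have the modulus of continuity of the pairing. -/
def normalizedModulus {E : Type*} [PseudoMetricSpace E] (P : C(X, E)) (x₀ : X) : Set C(X, ℝ) :=
  {f | (∀ x x', |f x - f x'| ≤ dist (P x) (P x')) ∧ f x₀ = 0}

lemma continuous_of_modulus {E : Type*} [PseudoMetricSpace E] (P : C(X, E)) {g : X → ℝ}
    (hg : ∀ x x', |g x - g x'| ≤ dist (P x) (P x')) : Continuous g := by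
  rw [continuous_iff_continuousAt]
  intro x
  rw [ContinuousAt, tendsto_iff_dist_tendsto_zero]
  refine squeeze_zero (fun _ => dist_nonneg) (fun x' => hg x' x) ?_
  exact tendsto_iff_dist_tendsto_zero.1 (P.continuous.tendsto x)

lemma isCompact_normalizedModulus {E : Type*} [PseudoMetricSpace E] (P : C(X, E)) (x₀ : X) :
    IsCompact (normalizedModulus P x₀) := by
  apply ArzelaAscoli.isCompact_of_equicontinuous
  · have himage : ContinuousMap.toFun '' normalizedModulus P x₀
        = {g : X → ℝ | (∀ x x', |g x - g x'| ≤ dist (P x) (P x')) ∧ g x₀ = 0} := by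
      ext g
      constructor
      · rintro ⟨f, hf, rfl⟩
        exact hf
      · intro hg
        exact ⟨⟨g, continuous_of_modulus P hg.1⟩, hg, rfl⟩
    rw [himage]
    refine (isCompact_univ_pi fun x => isCompact_closedBall (0 : ℝ)
      (dist (P x) (P x₀))).of_isClosed_subset ?_ ?_
    · simp only [ofPred_and, ofPred_forall]
      refine (isClosed_iInter fun x => isClosed_iInter fun x' => ?_).inter ?_
      · exact isClosed_le (by fun_prop) continuous_const
      · exact isClosed_eq (by fun_prop) continuous_const
    · intro g hg x _
      have := hg.1 x x₀
      rw [hg.2, sub_zero] at this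
      simpa using this
  · intro x
    rw [Metric.equicontinuousAt_iff_right]
    intro ε hε
    filter_upwards [P.continuous.tendsto x (Metric.ball_mem_nhds _ hε)] with x' hx' f
    rw [mem_preimage, Metric.mem_ball, dist_comm] at hx'
    exact (f.2.1 x x').trans_lt hx'

variable [CompactSpace X] [Nonempty X] [MeasurableSpace Y] [OpensMeasurableSpace Y]
  {ν : Measure Y} [IsProbabilityMeasure ν] {K : Set Y}

/-- The double transform does not increase the functional, and it has the modulus of continuity
of the pairing. -/
lemma exists_modulus_le (hp : Continuous fun z : X × Y => p z.1 z.2) [CompactSpace K]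
    (hνK : ν Kᶜ = 0) (θ : C(X, ℝ)) :
    ∃ η : C(X, ℝ), (∀ x x', |η x - η x'| ≤ dist (pairingOn hp K x) (pairingOn hp K x')) ∧
      η ≤ θ ∧ J p ν η ≤ J p ν θ := by
  have hK : IsCompact K := isCompact_iff_compactSpace.2 inferInstance
  have : Nonempty K := by
    by_contra h
    rw [not_nonempty_iff, isEmpty_coe_sort] at h
    simp [h] at hνK
  -- The supremum runs over `K` only: this gives a modulus uniform on a compact set, and as `ν`
  -- lives on `K` the comparison of transforms is needed only there.
  set g : X → ℝ := fun x => ⨆ y : K, (p x y - legendre p θ y)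
  have hbdd (x : X) : BddAbove (range fun y : K => p x y - legendre p θ y) := by
    refine ⟨θ x, ?_⟩
    rintro _ ⟨y, rfl⟩
    have := sub_le_legendre hp θ x y
    simp only
    linarith
  have hmod' (x x' : X) : g x - g x' ≤ dist (pairingOn hp K x) (pairingOn hp K x') := by
    rw [sub_le_iff_le_add]
    refine ciSup_le fun y => ?_
    have h1 := le_ciSup (hbdd x') y
    have h2 := (le_abs_self _).trans ((pairingOn hp K x).dist_apply_le_dist
      (g := pairingOn hp K x') y)
    change p x y - p x' y ≤ _ at h2
    change p x' y - legendre p θ y ≤ g x' at h1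
    linarith
  have hmod (x x' : X) : |g x - g x'| ≤ dist (pairingOn hp K x) (pairingOn hp K x') :=
    abs_sub_le_iff.2 ⟨hmod' x x', by rw [dist_comm]; exact hmod' x' x⟩
  refine ⟨⟨g, continuous_of_modulus _ hmod⟩, hmod, ?_, ?_⟩
  · intro x
    refine ciSup_le fun y => ?_
    have := sub_le_legendre hp θ x y
    change _ ≤ θ x
    linarith
  · refine integral_mono_ae (integrable_legendre hp hK hνK _) (integrable_legendre hp hK hνK _) ?_
    filter_upwards [compl_mem_ae_iff.2 hνK] with y hy
    refine ciSup_le fun x => ?_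
    have h1 := le_ciSup (hbdd x) ⟨y, not_not.1 hy⟩
    change p x y - legendre p θ y ≤ g x at h1
    change p x y - g x ≤ _
    linarith

/-- Applied with `A = (1/β) log ∫ e^{βθ} dμ₀` it gives minimizers of `F`; with `A = ∫ θ dμ` it gives
Kantorovich potentials. -/
lemma exists_isMinimizer_add_J (hp : Continuous fun z : X × Y => p z.1 z.2) (hK : IsCompact K)
    (hνK : ν Kᶜ = 0) {A : C(X, ℝ) → ℝ} (hA : Monotone A)
    (hAc : ∀ θ c, A (θ + ContinuousMap.const X c) = A θ + c) :
    ∃ θ, IsMinimizer (fun θ => A θ + J p ν θ) θ := by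
  -- Monotonicity and equivariance under constants make `A` 1-Lipschitz, since `f ≤ g + dist f g`.
  have hcont : Continuous A := by
    have key (f g : C(X, ℝ)) : A f - A g ≤ dist f g := by
      rw [sub_le_iff_le_add', ← hAc]
      apply hA
      intro x
      have := (le_abs_self _).trans (f.dist_apply_le_dist (g := g) x)
      change f x ≤ g x + dist f g
      linarith
    refine (LipschitzWith.of_dist_le_mul (K := 1) fun f g => ?_).continuous
    rw [NNReal.coe_one, one_mul, Real.dist_eq, abs_sub_le_iff]
    exact ⟨key f g, by rw [dist_comm]; exact key g f⟩
  have : CompactSpace K := isCompact_iff_compactSpace.1 hK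
  obtain ⟨x₀⟩ := ‹Nonempty X›
  obtain ⟨θ, -, hθ⟩ := (isCompact_normalizedModulus (pairingOn hp K) x₀).exists_isMinOn
    ⟨0, by simp [normalizedModulus]⟩ (hcont.add (continuous_J (ν := ν) hp hK hνK)).continuousOn
  refine ⟨θ, fun ψ => ?_⟩
  obtain ⟨η, hη, hle, hJ⟩ := exists_modulus_le hp hνK ψ
  -- Normalizing at `x₀` is free: the added constant cancels between `A` and `J`.
  have h := hθ (show η + ContinuousMap.const X (-η x₀) ∈ normalizedModulus (pairingOn hp K) x₀ by
    refine ⟨fun x x' => ?_, by simp⟩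
    simpa using hη x x')
  simp only [mem_ofPred_eq, Pi.add_apply, hAc, J_add_const hp hK hνK] at h
  have := hA hle
  simp only
  linarith

end Existence

/-! ### First variations and the Euler-Lagrange equation. -/

section FirstVariation

variable {X Y : Type*} [TopologicalSpace X] [CompactSpace X] [MeasurableSpace X] [BorelSpace X]

lemma _root_.ContinuousMap.integrable_of_compactSpace (f : C(X, ℝ)) (μ : Measure X)
    [IsFiniteMeasure μ] : Integrable f μ :=
  Integrable.of_bound f.continuous.measurable.aestronglyMeasurable ‖f‖
    (Filter.Eventually.of_forall f.norm_coe_le_norm)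

lemma monotone_integral (μ : Measure X) [IsFiniteMeasure μ] :
    Monotone fun θ : C(X, ℝ) => ∫ x, θ x ∂μ := fun f g hfg =>
  integral_mono (f.integrable_of_compactSpace μ) (g.integrable_of_compactSpace μ) hfg

lemma integral_add_const (μ : Measure X) [IsProbabilityMeasure μ] (θ : C(X, ℝ)) (c : ℝ) :
    ∫ x, (θ + ContinuousMap.const X c) x ∂μ = ∫ x, θ x ∂μ + c := by
  simp only [ContinuousMap.add_apply, ContinuousMap.const_apply]
  rw [integral_add (θ.integrable_of_compactSpace μ) (integrable_const c)]
  simp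

lemma hasDerivAt_integral (μ : Measure X) [IsFiniteMeasure μ] (θ v : C(X, ℝ)) :
    HasDerivAt (fun t : ℝ => ∫ x, (θ + t • v) x ∂μ) (∫ x, v x ∂μ) 0 := by
  have h (t : ℝ) : ∫ x, (θ + t • v) x ∂μ = ∫ x, θ x ∂μ + t * ∫ x, v x ∂μ := by
    simp only [ContinuousMap.add_apply, ContinuousMap.smul_apply, smul_eq_mul]
    rw [integral_add (θ.integrable_of_compactSpace μ)
      ((v.integrable_of_compactSpace μ).const_mul t), integral_const_mul]
  simp only [h]
  simpa using ((hasDerivAt_id (0 : ℝ)).mul_const (∫ x, v x ∂μ)).const_add (∫ x, θ x ∂μ)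

variable [T2Space X] [HasOuterApproxClosed X] [Nonempty X]
  [TopologicalSpace Y] [MeasurableSpace Y] [OpensMeasurableSpace Y] {p : X → Y → ℝ}
  {ν : Measure Y} [IsProbabilityMeasure ν] {K : Set Y}

lemma eq_map_of_isMinimizer (hp : Continuous fun z : X × Y => p z.1 z.2) (hK : IsCompact K)
    (hνK : ν Kᶜ = 0) {A : C(X, ℝ) → ℝ} {θ : C(X, ℝ)}
    (hθ : IsMinimizer (fun θ => A θ + J p ν θ) θ) {m : Measure X} [IsFiniteMeasure m]
    (hA : ∀ v : C(X, ℝ), HasDerivAt (fun t : ℝ => A (θ + t • v)) (∫ x, v x ∂m) 0)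
    {T : Y → X} (hT : Measurable T)
    (h : ∀ᵐ y ∂ν, ∀ x, legendre p θ y = p x y - θ x → x = T y) :
    m = ν.map T := by
  have : IsProbabilityMeasure (ν.map T) := Measure.isProbabilityMeasure_map hT.aemeasurable
  refine ext_of_forall_integral_eq_of_IsFiniteMeasure fun v => ?_
  have hd := (hA v.toContinuousMap).add (hasDerivAt_J hp hK hνK θ v.toContinuousMap hT h)
  have hmin : IsLocalMin ((fun t : ℝ => A (θ + t • v.toContinuousMap)) +
      fun t : ℝ => J p ν (θ + t • v.toContinuousMap)) 0 :=
    Filter.Eventually.of_forall fun t => by simpa using hθ (θ + t • v.toContinuousMap)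
  have h0 := hmin.hasDerivAt_eq_zero hd
  rw [integral_map hT.aemeasurable v.continuous.measurable.aestronglyMeasurable]
  simp only [BoundedContinuousFunction.coe_toContinuousMap] at h0
  linarith

end FirstVariation

section LogMGF

variable {X : Type*} [TopologicalSpace X] [CompactSpace X]
  [MeasurableSpace X] [BorelSpace X] (μ₀ : Measure X) [IsProbabilityMeasure μ₀]

lemma integrable_exp (θ : C(X, ℝ)) : Integrable (fun x => Real.exp (θ x)) μ₀ :=
  (⟨fun x => Real.exp (θ x), by fun_prop⟩ : C(X, ℝ)).integrable_of_compactSpace μ₀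

lemma logMGF_add_const (θ : C(X, ℝ)) (c : ℝ) :
    logMGF μ₀ (θ + ContinuousMap.const X c) = logMGF μ₀ θ + c := by
  have := integral_exp_pos (integrable_exp μ₀ θ)
  simp only [logMGF, ContinuousMap.add_apply, ContinuousMap.const_apply, Real.exp_add]
  rw [integral_mul_const, Real.log_mul this.ne' (Real.exp_ne_zero c), Real.log_exp]

lemma logMGF_mono : Monotone (logMGF μ₀) := fun f g hfg =>
  Real.log_le_log (integral_exp_pos (integrable_exp μ₀ f))
    (integral_mono (integrable_exp μ₀ f) (integrable_exp μ₀ g) fun x => Real.exp_le_exp.2 (hfg x))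

/-- For `β < 0` the order is reversed twice, so existence needs no case distinction on the sign. -/
lemma monotone_inv_mul_logMGF (β : ℝ) :
    Monotone fun θ : C(X, ℝ) => 1 / β * logMGF μ₀ (β • θ) := by
  intro f g hfg
  rcases le_total 0 β with h | h
  · refine mul_le_mul_of_nonneg_left (logMGF_mono μ₀ fun x => ?_) (one_div_nonneg.2 h)
    exact mul_le_mul_of_nonneg_left (hfg x) h
  · refine mul_le_mul_of_nonpos_left (logMGF_mono μ₀ fun x => ?_) (one_div_nonpos.2 h)
    exact mul_le_mul_of_nonpos_left (hfg x) h

lemma inv_mul_logMGF_add_const {β : ℝ} (hβ : β ≠ 0) (θ : C(X, ℝ)) (c : ℝ) :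
    1 / β * logMGF μ₀ (β • (θ + ContinuousMap.const X c))
      = 1 / β * logMGF μ₀ (β • θ) + c := by
  have : β • (θ + ContinuousMap.const X c) = β • θ + ContinuousMap.const X (β * c) := by
    ext x
    simp
  rw [this, logMGF_add_const]
  field_simp

/-- Up to an additive constant the function of `t` is the cumulant generating function of `v` under
the tilted measure, whose derivative at `0` is the mean. -/
lemma hasDerivAt_logMGF (θ v : C(X, ℝ)) :
    HasDerivAt (fun t : ℝ => logMGF μ₀ (θ + t • v)) (∫ x, v x ∂(μ₀.tilted θ)) 0 := by
  have := isProbabilityMeasure_tilted (integrable_exp μ₀ θ)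
  have hset : ProbabilityTheory.integrableExpSet v (μ₀.tilted θ) = univ :=
    eq_univ_of_forall fun t => integrable_exp (μ₀.tilted θ) (t • v)
  have h0 : (0 : ℝ) ∈ interior (ProbabilityTheory.integrableExpSet v (μ₀.tilted θ)) := by
    simp [hset]
  have hd := (ProbabilityTheory.analyticAt_cgf h0).differentiableAt.hasDerivAt
  rw [ProbabilityTheory.deriv_cgf_zero h0, probReal_univ, div_one] at hd
  refine (hd.const_add (logMGF μ₀ θ)).congr_of_eventuallyEq
    (Filter.Eventually.of_forall fun t => ?_)
  have hpos := integral_exp_pos (integrable_exp μ₀ θ)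
  have hpos' := integral_exp_pos (integrable_exp (μ₀.tilted θ) (t • v))
  have := integral_exp_tilted (μ := μ₀) θ (t • v : C(X, ℝ))
  simp only [ProbabilityTheory.cgf, ProbabilityTheory.mgf, logMGF]
  simp only [ContinuousMap.smul_apply, smul_eq_mul] at hpos'
  rw [← Real.log_mul hpos.ne' hpos'.ne']
  congr 1
  simp only [ContinuousMap.smul_apply, smul_eq_mul, Pi.add_apply] at this
  rw [this, mul_div_cancel₀ _ hpos.ne']
  rfl

lemma hasDerivAt_inv_mul_logMGF {β : ℝ} (hβ : β ≠ 0) (θ v : C(X, ℝ)) :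
    HasDerivAt (fun t : ℝ => 1 / β * logMGF μ₀ (β • (θ + t • v)))
      (∫ x, v x ∂(μ₀.tilted fun x => β * θ x)) 0 := by
  have h := (hasDerivAt_logMGF μ₀ (β • θ) (β • v)).const_mul (1 / β)
  have e : 1 / β * ∫ x, (β • v) x ∂(μ₀.tilted (β • θ : C(X, ℝ)))
      = ∫ x, v x ∂(μ₀.tilted fun x => β * θ x) := by
    simp only [ContinuousMap.smul_apply, smul_eq_mul, integral_const_mul]
    rw [← mul_assoc, one_div_mul_cancel hβ, one_mul]
    rfl
  rw [e] at h
  simpa only [smul_add, smul_comm β] using h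

end LogMGF

end MAGibbs

namespace MAGibbs

/-! ### Gibbs measures and the entropy identity. -/

section Gibbs

open InformationTheory

lemma _root_.EReal.eq_zero_of_coe_add_coe_ennreal_le {a b : ℝ} {k : ENNReal} (hab : a ≤ b)
    (h : (b : EReal) + k ≤ a) : k = 0 ∧ a = b := by
  have hk : k ≠ ⊤ := by
    rintro rfl
    rw [EReal.coe_ennreal_top, EReal.coe_add_top, top_le_iff] at h
    exact EReal.coe_ne_top a h
  rw [← EReal.coe_ennreal_toReal hk, ← EReal.coe_add, EReal.coe_le_coe_iff] at h
  have h0 := ENNReal.toReal_nonneg (a := k)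
  refine ⟨?_, by linarith⟩
  have : k.toReal = 0 := by linarith
  exact ((ENNReal.toReal_eq_zero_iff k).1 this).resolve_right hk

lemma isMinimizer_G_iff {X Y : Type*} [MeasurableSpace X] [MeasurableSpace Y] {p : X → Y → ℝ}
    {β : ℝ} {μ₀ : Measure X} {ν : Measure Y} {μ : ProbabilityMeasure X} :
    IsMinimizer (G p β μ₀ ν) μ ↔ IsMinimizer (freeEnergy p β μ₀ ν) μ :=
  forall_congr' fun _ => (EReal.addLECancellable_coe _).add_le_add_iff_right

variable {X : Type*} [TopologicalSpace X] [CompactSpace X] [MeasurableSpace X] [BorelSpace X]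
  (μ₀ : Measure X) [IsProbabilityMeasure μ₀]

/-- The Gibbs variational principle in the form of an identity. -/
lemma klDiv_eq_klDiv_tilted_add (μ : Measure X) [IsProbabilityMeasure μ] (g : C(X, ℝ)) :
    (klDiv μ μ₀ : EReal)
      = klDiv μ (μ₀.tilted g) + ((∫ x, g x ∂μ - logMGF μ₀ g : ℝ) : EReal) := by
  have hg := integrable_exp μ₀ g
  have hprob := isProbabilityMeasure_tilted hg
  have hgμ := g.integrable_of_compactSpace μ
  by_cases h : μ ≪ μ₀ ∧ Integrable (llr μ μ₀) μ
  · have h' : μ ≪ μ₀.tilted g := h.1.trans (absolutelyContinuous_tilted hg)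
    have hi := integrable_llr_tilted_right h.1 hgμ h.2 hg
    rw [← EReal.coe_ennreal_toReal (klDiv_ne_top_iff.2 h),
      ← EReal.coe_ennreal_toReal (klDiv_ne_top_iff.2 ⟨h', hi⟩), ← EReal.coe_add,
      toReal_klDiv_of_measure_eq h.1 (by simp), toReal_klDiv_of_measure_eq h' (by simp),
      integral_llr_tilted_right h.1 hgμ hg h.2]
    congr 1
    simp only [logMGF]
    ring
  -- Tilting back by `-g` shows that finiteness of one entropy implies that of the other; here both
  -- are infinite.
  · have h' : ¬ (μ ≪ μ₀.tilted g ∧ Integrable (llr μ (μ₀.tilted g)) μ) := by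
      rintro ⟨h1, h2⟩
      refine h ⟨h1.trans (tilted_absolutelyContinuous _ _), ?_⟩
      have := integrable_llr_tilted_right h1 hgμ.neg h2 (integrable_exp (μ₀.tilted g) (-g))
      rwa [tilted_neg_same hg] at this
    rw [← klDiv_ne_top_iff, not_not] at h h'
    rw [h, h', EReal.coe_ennreal_top, EReal.top_add_coe]

/-- The two densities agree a.e., hence everywhere by continuity and full support; take logarithms.
-/
lemma exists_add_const_of_tilted_eq [μ₀.IsOpenPosMeasure] {f g : C(X, ℝ)}
    (h : μ₀.tilted f = μ₀.tilted g) : ∃ c : ℝ, ∀ x, g x = f x + c := by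
  have hf := integral_exp_pos (integrable_exp μ₀ f)
  have hg := integral_exp_pos (integrable_exp μ₀ g)
  have hmeas (f : C(X, ℝ)) : Measurable fun x =>
      ENNReal.ofReal (Real.exp (f x) / ∫ x, Real.exp (f x) ∂μ₀) :=
    (f.continuous.measurable.exp.div_const _).ennreal_ofReal
  have h1 := (withDensity_eq_iff_of_sigmaFinite (hmeas f).aemeasurable (hmeas g).aemeasurable).1 h
  have h2 : (fun x => Real.exp (f x) / ∫ x, Real.exp (f x) ∂μ₀)
      = fun x => Real.exp (g x) / ∫ x, Real.exp (g x) ∂μ₀ := by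
    refine (Continuous.ae_eq_iff_eq μ₀ (by fun_prop) (by fun_prop)).1 ?_
    filter_upwards [h1] with x hx
    exact (ENNReal.ofReal_eq_ofReal_iff (by positivity) (by positivity)).1 hx
  refine ⟨logMGF μ₀ g - logMGF μ₀ f, fun x => ?_⟩
  have h3 := congrArg Real.log (congrFun h2 x)
  simp only [Real.log_div (Real.exp_ne_zero _) hf.ne', Real.log_div (Real.exp_ne_zero _) hg.ne',
    Real.log_exp] at h3
  simp only [logMGF]
  linarith

/-- The Gibbs measure `e^{βθ} μ₀ / ∫ e^{βθ} dμ₀`. -/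
noncomputable def gibbs (β : ℝ) (θ : C(X, ℝ)) : ProbabilityMeasure X :=
  ⟨μ₀.tilted fun x => β * θ x, isProbabilityMeasure_tilted (integrable_exp μ₀ (β • θ))⟩

lemma exists_add_const_of_gibbs_eq [μ₀.IsOpenPosMeasure] {β : ℝ} (hβ : β ≠ 0) {θ ψ : C(X, ℝ)}
    (h : gibbs μ₀ β θ = gibbs μ₀ β ψ) : ∃ c : ℝ, ∀ x, ψ x = θ x + c := by
  obtain ⟨c, hc⟩ := exists_add_const_of_tilted_eq μ₀ (f := β • θ) (g := β • ψ)
    (congrArg Subtype.val h)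
  refine ⟨c / β, fun x => mul_left_cancel₀ hβ ?_⟩
  have := hc x
  simp only [ContinuousMap.smul_apply, smul_eq_mul] at this
  rw [this]
  field_simp

lemma gibbs_add_const {β : ℝ} {θ ψ : C(X, ℝ)} {c : ℝ} (h : ∀ x, ψ x = θ x + c) :
    gibbs μ₀ β ψ = gibbs μ₀ β θ := by
  obtain rfl : ψ = θ + ContinuousMap.const X c := ContinuousMap.ext h
  refine Subtype.ext ?_
  have hpos := integral_exp_pos (integrable_exp μ₀ (β • θ))
  simp only [gibbs, Measure.tilted, ContinuousMap.add_apply, ContinuousMap.const_apply, mul_add,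
    Real.exp_add, integral_mul_const, mul_div_mul_right _ _ (Real.exp_ne_zero _)]

lemma freeEnergy_eq {Y : Type*} [MeasurableSpace Y] {p : X → Y → ℝ} {β : ℝ} {ν : Measure Y}
    (hβ : β ≠ 0) (θ : C(X, ℝ)) (μ : ProbabilityMeasure X) :
    freeEnergy p β μ₀ ν μ
      = ((-(β * F p β μ₀ ν θ) + β * (W22 p (μ : Measure X) ν
          + (∫ x, θ x ∂(μ : Measure X) + J p ν θ)) : ℝ) : EReal)
        + (InformationTheory.klDiv (μ : Measure X) (μ₀.tilted fun x => β * θ x) : EReal) := by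
  have h := klDiv_eq_klDiv_tilted_add μ₀ (μ : Measure X) (β • θ)
  rw [freeEnergy, h, add_left_comm, ← EReal.coe_add, add_comm]
  congr 2
  simp only [F, ContinuousMap.smul_apply, smul_eq_mul, integral_const_mul]
  field_simp
  ring

end Gibbs

/-! ### Kantorovich duality. -/

section Transport

variable {X Y : Type*} [TopologicalSpace X] [CompactSpace X] [MeasurableSpace X] [BorelSpace X]
  [TopologicalSpace Y] [MeasurableSpace Y] [BorelSpace Y] [SecondCountableTopologyEither X Y]
  {p : X → Y → ℝ} {ν : Measure Y} [IsProbabilityMeasure ν] {K : Set Y}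
  (μ : Measure X)

/-- Weak Kantorovich duality for a single transport plan. -/
lemma le_integral_of_mem_plans (hp : Continuous fun z : X × Y => p z.1 z.2) (hK : IsCompact K)
    (hνK : ν Kᶜ = 0) (θ : C(X, ℝ)) {γ : Measure (X × Y)} (hγ : γ ∈ plans μ ν) :
    -(∫ x, θ x ∂μ + J p ν θ) ≤ ∫ z, -p z.1 z.2 ∂γ := by
  obtain ⟨h1, h2⟩ := hγ
  have : IsProbabilityMeasure γ := ⟨by rw [← Measure.snd_univ, h2, measure_univ]⟩
  have hγK : γ (univ ×ˢ K)ᶜ = 0 := by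
    have hae : ∀ᵐ z ∂γ, z.2 ∈ K := by
      apply ae_of_ae_map (f := Prod.snd) measurable_snd.aemeasurable
      change ∀ᵐ y ∂γ.snd, y ∈ K
      rw [h2]
      exact hνK
    rw [← mem_ae_iff]
    filter_upwards [hae] with z hz
    exact ⟨mem_univ _, hz⟩
  have hcompact : IsCompact ((univ : Set X) ×ˢ K) := isCompact_univ.prod hK
  have hθ : Continuous fun z : X × Y => θ z.1 := by fun_prop
  have hl : Continuous fun z : X × Y => legendre p θ z.2 :=
    (continuous_legendre hp θ).comp continuous_snd
  have hint {g : X × Y → ℝ} (hg : Continuous g) : Integrable g γ :=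
    hg.integrable_of_measure_compl_eq_zero hcompact hγK
  have e1 : ∫ x, θ x ∂μ = ∫ z, θ z.1 ∂γ := by
    rw [← h1, Measure.fst, integral_map measurable_fst.aemeasurable
      θ.continuous.measurable.aestronglyMeasurable]
  have e2 : J p ν θ = ∫ z, legendre p θ z.2 ∂γ := by
    rw [J, ← h2, Measure.snd, integral_map measurable_snd.aemeasurable
      (continuous_legendre hp θ).measurable.aestronglyMeasurable]
  rw [e1, e2, ← integral_add (hint hθ) (hint hl), ← integral_neg]
  refine integral_mono ((hint hθ).add (hint hl)).neg (hint hp.neg) fun z => ?_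
  have := sub_le_legendre hp θ z.1 z.2
  simp only
  linarith

variable [IsProbabilityMeasure μ]

lemma le_W22 (hp : Continuous fun z : X × Y => p z.1 z.2) (hK : IsCompact K)
    (hνK : ν Kᶜ = 0) (θ : C(X, ℝ)) : 0 ≤ W22 p μ ν + (∫ x, θ x ∂μ + J p ν θ) := by
  rw [← neg_le_iff_add_nonneg]
  refine le_csInf (Set.Nonempty.image _ ⟨μ.prod ν, by simp [plans]⟩) ?_
  rintro _ ⟨γ, hγ, rfl⟩
  exact le_integral_of_mem_plans μ hp hK hνK θ hγ

variable [Nonempty X]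

/-- The plan carried by the graph of `T` turns the pointwise inequality behind weak duality into an
a.e. equality. -/
lemma W22_add_eq_zero (hp : Continuous fun z : X × Y => p z.1 z.2) (hK : IsCompact K)
    (hνK : ν Kᶜ = 0) {θ : C(X, ℝ)} {T : Y → X} (hT : Measurable T)
    (h : ∀ᵐ y ∂ν, ∀ x, legendre p θ y = p x y - θ x → x = T y) (hμ : μ = ν.map T) :
    W22 p μ ν + (∫ x, θ x ∂μ + J p ν θ) = 0 := by
  refine le_antisymm ?_ (le_W22 μ hp hK hνK θ)
  have hTi : Measurable fun y => (T y, y) := hT.prodMk measurable_id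
  have hplan : ν.map (fun y => (T y, y)) ∈ plans μ ν := by
    refine ⟨?_, ?_⟩
    · rw [Measure.fst_map_prodMk (X := T) (Y := fun y => y) measurable_id, hμ]
    · rw [Measure.snd_map_prodMk hT]
      exact Measure.map_id
  have hle : W22 p μ ν ≤ ∫ z, -p z.1 z.2 ∂(ν.map fun y => (T y, y)) := by
    refine csInf_le ⟨-(∫ x, θ x ∂μ + J p ν θ), ?_⟩ (mem_image_of_mem _ hplan)
    rintro _ ⟨γ, hγ, rfl⟩
    exact le_integral_of_mem_plans μ hp hK hνK θ hγ
  have hθT : Integrable (fun y => θ (T y)) ν :=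
    (hμ ▸ θ.integrable_of_compactSpace μ : Integrable θ (ν.map T)).comp_measurable hT
  have e : ∫ z, -p z.1 z.2 ∂(ν.map fun y => (T y, y)) = -(∫ x, θ x ∂μ + J p ν θ) := by
    rw [integral_map hTi.aemeasurable (f := fun z : X × Y => -p z.1 z.2)
      hp.neg.measurable.aestronglyMeasurable, hμ,
      integral_map hT.aemeasurable θ.continuous.measurable.aestronglyMeasurable, J,
      ← integral_add hθT (integrable_legendre hp hK hνK θ), ← integral_neg]
    refine integral_congr_ae ?_
    filter_upwards [h] with y hy
    obtain ⟨x, hx⟩ := exists_legendre_eq hp θ y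
    obtain rfl := hy x hx
    linarith
  linarith

end Transport

/-! ### Correspondence between minimizers of `F` and of `G`. -/

section Duality

variable {X Y : Type*} [TopologicalSpace X] [CompactSpace X] [Nonempty X]
  [MeasurableSpace X] [BorelSpace X] [TopologicalSpace Y] [MeasurableSpace Y] [BorelSpace Y]
  {p : X → Y → ℝ} {ν : Measure Y} [IsProbabilityMeasure ν] {K : Set Y}

/-- The pairing satisfies the twist condition `ν`-almost everywhere: for every `θ` the maximizer
in `legendre p θ y` is unique for almost every `y`, and depends measurably on `y`. -/
def IsTwisted (p : X → Y → ℝ) (ν : Measure Y) : Prop :=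
  ∀ θ : C(X, ℝ), ∃ T : Y → X, Measurable T ∧
    ∀ᵐ y ∂ν, ∀ x, legendre p θ y = p x y - θ x → x = T y

variable {β : ℝ} (μ₀ : Measure X) [IsProbabilityMeasure μ₀]

lemma exists_isMinimizer_F (hp : Continuous fun z : X × Y => p z.1 z.2) (hK : IsCompact K)
    (hνK : ν Kᶜ = 0) (hβ : β ≠ 0) : ∃ θ, IsMinimizer (F p β μ₀ ν) θ :=
  exists_isMinimizer_add_J hp hK hνK (monotone_inv_mul_logMGF μ₀ β) (inv_mul_logMGF_add_const μ₀ hβ)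

variable [T2Space X] [HasOuterApproxClosed X]

/-- The Monge-Ampère equation is the Euler-Lagrange equation of `F`. -/
lemma tilted_eq_map (hp : Continuous fun z : X × Y => p z.1 z.2) (hK : IsCompact K)
    (hνK : ν Kᶜ = 0) (hβ : β ≠ 0) {θ : C(X, ℝ)} (hθ : IsMinimizer (F p β μ₀ ν) θ)
    {T : Y → X} (hT : Measurable T)
    (h : ∀ᵐ y ∂ν, ∀ x, legendre p θ y = p x y - θ x → x = T y) :
    (μ₀.tilted fun x => β * θ x) = ν.map T :=
  have : IsProbabilityMeasure (μ₀.tilted fun x => β * θ x) :=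
    isProbabilityMeasure_tilted (integrable_exp μ₀ (β • θ))
  eq_map_of_isMinimizer hp hK hνK (A := fun θ => 1 / β * logMGF μ₀ (β • θ)) hθ
    (hasDerivAt_inv_mul_logMGF μ₀ hβ θ) hT h

variable [SecondCountableTopologyEither X Y]

/-- Strong Kantorovich duality, with attainment on the dual side. -/
lemma exists_W22_add_eq_zero (hp : Continuous fun z : X × Y => p z.1 z.2) (hK : IsCompact K)
    (hνK : ν Kᶜ = 0) (hT : IsTwisted p ν) (μ : Measure X) [IsProbabilityMeasure μ] :
    ∃ θ : C(X, ℝ), W22 p μ ν + (∫ x, θ x ∂μ + J p ν θ) = 0 := by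
  obtain ⟨θ, hθ⟩ := exists_isMinimizer_add_J hp hK hνK (monotone_integral μ) (integral_add_const μ)
  obtain ⟨T, hTm, h⟩ := hT θ
  exact ⟨θ, W22_add_eq_zero μ hp hK hνK hTm h
    (eq_map_of_isMinimizer hp hK hνK hθ (hasDerivAt_integral μ θ) hTm h)⟩

lemma freeEnergy_gibbs (hp : Continuous fun z : X × Y => p z.1 z.2) (hK : IsCompact K)
    (hνK : ν Kᶜ = 0) (hT : IsTwisted p ν) (hβ : β ≠ 0) {θ : C(X, ℝ)}
    (hθ : IsMinimizer (F p β μ₀ ν) θ) :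
    freeEnergy p β μ₀ ν (gibbs μ₀ β θ) = ((-(β * F p β μ₀ ν θ) : ℝ) : EReal) := by
  obtain ⟨T, hTm, h⟩ := hT θ
  have hW := W22_add_eq_zero (gibbs μ₀ β θ : Measure X) hp hK hνK hTm h
    (tilted_eq_map μ₀ hp hK hνK hβ hθ hTm h)
  rw [freeEnergy_eq μ₀ hβ θ, hW]
  simp [gibbs]

lemma isMinimizer_gibbs (hp : Continuous fun z : X × Y => p z.1 z.2) (hK : IsCompact K)
    (hνK : ν Kᶜ = 0) (hT : IsTwisted p ν) (hβ : β ≠ 0) {θ : C(X, ℝ)}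
    (hθ : IsMinimizer (F p β μ₀ ν) θ) : IsMinimizer (G p β μ₀ ν) (gibbs μ₀ β θ) := by
  rw [isMinimizer_G_iff]
  intro μ
  rw [freeEnergy_gibbs μ₀ hp hK hνK hT hβ hθ]
  rcases hβ.lt_or_gt with hneg | hpos
  -- For `β < 0` the gap enters with the wrong sign, so it is removed by a potential adapted to `μ`;
  -- then `F θ ≤ F θ'` gives the bound.
  · obtain ⟨θ', h'⟩ := exists_W22_add_eq_zero hp hK hνK hT (μ : Measure X)
    rw [freeEnergy_eq μ₀ hβ θ', h', mul_zero, add_zero]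
    refine le_add_of_le_of_nonneg (EReal.coe_le_coe_iff.2 ?_) (EReal.coe_ennreal_nonneg _)
    exact neg_le_neg (mul_le_mul_of_nonpos_left (hθ θ') hneg.le)
  · rw [freeEnergy_eq μ₀ hβ θ]
    refine le_add_of_le_of_nonneg (EReal.coe_le_coe_iff.2 ?_) (EReal.coe_ennreal_nonneg _)
    exact le_add_of_nonneg_right (mul_nonneg hpos.le (le_W22 _ hp hK hνK θ))

lemma exists_eq_gibbs (hp : Continuous fun z : X × Y => p z.1 z.2) (hK : IsCompact K)
    (hνK : ν Kᶜ = 0) (hT : IsTwisted p ν) (hβ : β ≠ 0) {μ : ProbabilityMeasure X}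
    (hμ : IsMinimizer (G p β μ₀ ν) μ) :
    ∃ θ, IsMinimizer (F p β μ₀ ν) θ ∧ μ = gibbs μ₀ β θ := by
  rw [isMinimizer_G_iff] at hμ
  obtain ⟨θ, hθ⟩ := exists_isMinimizer_F μ₀ hp hK hνK hβ
  have hle := hμ (gibbs μ₀ β θ)
  rw [freeEnergy_gibbs μ₀ hp hK hνK hT hβ hθ] at hle
  have hprob (θ : C(X, ℝ)) := (gibbs μ₀ β θ).2
  rcases hβ.lt_or_gt with hneg | hpos
  · obtain ⟨θ', h'⟩ := exists_W22_add_eq_zero hp hK hνK hT (μ : Measure X)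
    rw [freeEnergy_eq μ₀ hβ θ', h', mul_zero, add_zero] at hle
    obtain ⟨h1, h2⟩ := EReal.eq_zero_of_coe_add_coe_ennreal_le
      (neg_le_neg (mul_le_mul_of_nonpos_left (hθ θ') hneg.le)) hle
    -- Equality forces `F θ' = F θ`, so the potential adapted to `μ` is itself a minimizer of `F`.
    have h3 := mul_left_cancel₀ hβ (neg_injective h2)
    refine ⟨θ', fun ψ => h3 ▸ hθ ψ, ?_⟩
    have := hprob θ'
    have e := InformationTheory.klDiv_eq_zero_iff.1 h1
    exact Subtype.ext e
  · rw [freeEnergy_eq μ₀ hβ θ] at hle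
    obtain ⟨h1, -⟩ := EReal.eq_zero_of_coe_add_coe_ennreal_le
      (le_add_of_nonneg_right (mul_nonneg hpos.le (le_W22 _ hp hK hνK θ))) hle
    refine ⟨θ, hθ, ?_⟩
    have := hprob θ
    have e := InformationTheory.klDiv_eq_zero_iff.1 h1
    exact Subtype.ext e

/-- If the minimizer of `F` is unique up to constants, its Gibbs measure is the only minimizer
of `G`. -/
lemma eq_gibbs_of_isUniqueMinimizerModConst (hp : Continuous fun z : X × Y => p z.1 z.2)
    (hK : IsCompact K) (hνK : ν Kᶜ = 0) (hT : IsTwisted p ν) (hβ : β ≠ 0) {φ : C(X, ℝ)}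
    (hφ : IsUniqueMinimizerModConst (F p β μ₀ ν) φ) {μ : ProbabilityMeasure X}
    (hμ : IsMinimizer (G p β μ₀ ν) μ) : μ = gibbs μ₀ β φ := by
  obtain ⟨θ, hθ, rfl⟩ := exists_eq_gibbs μ₀ hp hK hνK hT hβ hμ
  obtain ⟨c, hc⟩ := hφ.2 θ hθ
  exact gibbs_add_const μ₀ hc

theorem exists_isUniqueMinimizerModConst_iff [μ₀.IsOpenPosMeasure]
    (hp : Continuous fun z : X × Y => p z.1 z.2)
    (hK : IsCompact K) (hνK : ν Kᶜ = 0) (hT : IsTwisted p ν) (hβ : β ≠ 0) :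
    (∃ φ, IsUniqueMinimizerModConst (F p β μ₀ ν) φ) ↔ ∃! μ, IsMinimizer (G p β μ₀ ν) μ := by
  constructor
  · rintro ⟨φ, hφ⟩
    exact ⟨gibbs μ₀ β φ, isMinimizer_gibbs μ₀ hp hK hνK hT hβ hφ.1, fun μ hμ =>
      eq_gibbs_of_isUniqueMinimizerModConst μ₀ hp hK hνK hT hβ hφ hμ⟩
  · intro h
    obtain ⟨φ, hφ⟩ := exists_isMinimizer_F μ₀ hp hK hνK hβ
    exact ⟨φ, hφ, fun ψ hψ => exists_add_const_of_gibbs_eq μ₀ hβ (h.unique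
      (isMinimizer_gibbs μ₀ hp hK hνK hT hβ hφ) (isMinimizer_gibbs μ₀ hp hK hνK hT hβ hψ))⟩

end Duality

end MAGibbs

namespace MAGibbs

/-! ### The twist condition in the two settings. -/

section Gradient

variable {E : Type*} [NormedAddCommGroup E] [InnerProductSpace ℝ E] [CompleteSpace E]

lemma measurable_gradient [MeasurableSpace E] [BorelSpace E] (f : E → ℝ) :
    Measurable (gradient f) :=
  (InnerProductSpace.toDual ℝ E).symm.continuous.measurable.comp (measurable_fderiv ℝ f)

lemma gradient_eq_of_touching {u l : E → ℝ} {g y : E} (hu : DifferentiableAt ℝ u y)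
    (hl : HasGradientAt l g y) (hle : ∀ z, l z ≤ u z) (heq : u y = l y) : gradient u y = g := by
  have hd := hu.hasGradientAt.hasFDerivAt.sub hl.hasFDerivAt
  have hmin : IsLocalMin (u - l) y := Filter.Eventually.of_forall fun z => by
    simpa [heq] using hle z
  have h0 := hmin.hasFDerivAt_eq_zero hd
  exact (InnerProductSpace.toDual ℝ E).injective (sub_eq_zero.1 h0)

end Gradient

lemma abs_legendre_sub_legendre_le_of_forall {X Y : Type*} [TopologicalSpace X] [CompactSpace X]
    [Nonempty X] [TopologicalSpace Y] {p : X → Y → ℝ} (hp : Continuous fun z : X × Y => p z.1 z.2)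
    (f : C(X, ℝ)) {y y' : Y} {C : ℝ} (h : ∀ x, |p x y - p x y'| ≤ C) :
    |legendre p f y - legendre p f y'| ≤ C := by
  obtain ⟨x, hx⟩ := exists_legendre_eq hp f y
  obtain ⟨x', hx'⟩ := exists_legendre_eq hp f y'
  have h1 := sub_le_legendre hp f x y'
  have h2 := sub_le_legendre hp f x' y
  have h3 := abs_le.1 (h x)
  have h4 := abs_le.1 (h x')
  rw [abs_le]
  constructor <;> linarith

section Euclidean

variable {d : ℕ} {X : Set (EuclideanSpace ℝ (Fin d))}

lemma continuous_euclPairing :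
    Continuous fun z : X × EuclideanSpace ℝ (Fin d) => euclPairing X z.1 z.2 := by
  unfold euclPairing
  fun_prop

lemma ae_differentiableAt_legendre_euclPairing [CompactSpace X] [Nonempty X] (θ : C(X, ℝ)) :
    ∀ᵐ y, DifferentiableAt ℝ (legendre (euclPairing X) θ) y := by
  obtain ⟨C, hC⟩ := (isCompact_iff_compactSpace.2 ‹CompactSpace X›).exists_bound_of_continuousOn
    (f := fun x => x) continuousOn_id
  refine LipschitzWith.ae_differentiableAt (C := C.toNNReal) ?_
  refine LipschitzWith.of_dist_le_mul fun y y' => ?_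
  refine abs_legendre_sub_legendre_le_of_forall continuous_euclPairing θ fun x => ?_
  rw [euclPairing, euclPairing, ← inner_sub_right, dist_eq_norm]
  refine (abs_real_inner_le_norm _ _).trans (mul_le_mul_of_nonneg_right ?_ (norm_nonneg _))
  exact (hC x x.2).trans (Real.le_coe_toNNReal C)

lemma eq_gradient_of_legendre_eq [CompactSpace X] {θ : C(X, ℝ)}
    {y : EuclideanSpace ℝ (Fin d)} (hy : DifferentiableAt ℝ (legendre (euclPairing X) θ) y) {x : X}
    (hx : legendre (euclPairing X) θ y = euclPairing X x y - θ x) :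
    gradient (legendre (euclPairing X) θ) y = x := by
  refine gradient_eq_of_touching (l := fun y => euclPairing X x y - θ x) hy ?_
    (fun z => sub_le_legendre continuous_euclPairing θ x z) hx
  have := ((InnerProductSpace.toDual ℝ (EuclideanSpace ℝ (Fin d))
    (x : EuclideanSpace ℝ (Fin d))).hasFDerivAt (x := y)).sub_const (θ x)
  exact this

lemma exists_gradient_map [CompactSpace X] [Nonempty X]
    {ν : Measure (EuclideanSpace ℝ (Fin d))} (hν : ν ≪ volume) (θ : C(X, ℝ)) :
    ∃ T : EuclideanSpace ℝ (Fin d) → X, Measurable T ∧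
      (∀ᵐ y ∂ν, ∀ x, legendre (euclPairing X) θ y = euclPairing X x y - θ x → x = T y) ∧
      (ν.map T).map Subtype.val = euclMA X ν θ := by
  classical
  obtain ⟨x₀⟩ := ‹Nonempty X›
  have hX : MeasurableSet X :=
    (isCompact_iff_compactSpace.2 ‹CompactSpace X›).isClosed.measurableSet
  set u := legendre (euclPairing X) θ
  have hG : Measurable (gradient u) := measurable_gradient u
  -- On a `ν`-null set the gradient may fall outside `X`; the value `x₀` there makes the map
  -- `X`-valued without changing the push-forward.
  have hmem : ∀ y, (if gradient u y ∈ X then gradient u y else (x₀ : EuclideanSpace ℝ (Fin d)))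
      ∈ X := fun y => by split_ifs with h; exacts [h, x₀.2]
  have hT : Measurable fun y => (⟨_, hmem y⟩ : X) :=
    (Measurable.ite (hG hX) hG measurable_const).subtype_mk
  have hgrad : ∀ᵐ y ∂ν, ∀ x, u y = euclPairing X x y - θ x → gradient u y = x :=
    hν.ae_le ((ae_differentiableAt_legendre_euclPairing θ).mono fun y hy x hx =>
      eq_gradient_of_legendre_eq hy hx)
  refine ⟨_, hT, ?_, ?_⟩
  · filter_upwards [hgrad] with y hy x hx
    have := hy x hx
    refine Subtype.ext ?_
    simp [this]
  · rw [Measure.map_map measurable_subtype_coe hT]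
    refine Measure.map_congr ?_
    filter_upwards [hgrad] with y hy
    have : Nonempty X := ⟨x₀⟩
    obtain ⟨x, hx⟩ := exists_legendre_eq continuous_euclPairing θ y
    have := hy x hx
    simp only [Function.comp, this]
    rw [if_pos x.2, ← this]

end Euclidean

section Torus

variable {d : ℕ}

lemma torusProj_add (v w : EuclideanSpace ℝ (Fin d)) :
    torusProj (v + w) = torusProj v + torusProj w := by
  ext i
  simp [torusProj]

lemma _root_.UnitAddCircle.norm_coe_le (r : ℝ) : ‖(r : UnitAddCircle)‖ ≤ |r| := by
  rw [UnitAddCircle.norm_eq]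
  simpa using round_le r 0

lemma continuous_torusPairing :
    Continuous fun z : Torus d × Torus d => torusPairing z.1 z.2 := by
  unfold torusPairing
  fun_prop

/-- A measurable section of the projection `ℝᵈ → ℝᵈ / ℤᵈ`. -/
noncomputable def torusLift (y : Torus d) : EuclideanSpace ℝ (Fin d) :=
  WithLp.toLp 2 fun i => (AddCircle.measurableEquivIoc 1 0 (y i) : ℝ)

lemma measurable_torusLift : Measurable (torusLift : Torus d → EuclideanSpace ℝ (Fin d)) := by
  refine (WithLp.measurable_toLp 2 (Fin d → ℝ)).comp (measurable_pi_lambda _ fun i => ?_)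
  exact measurable_subtype_coe.comp
    ((AddCircle.measurableEquivIoc 1 0).measurable.comp (measurable_pi_apply i))

lemma torusProj_torusLift (y : Torus d) : torusProj (torusLift y) = y := by
  ext i
  exact (AddCircle.measurableEquivIoc 1 0).symm_apply_apply (y i)

/-- Moves the base point to a lift in `ℝᵈ`, where measurability of the derivative is available. -/
lemma torusGradient_eq (u : Torus d → ℝ) (y : Torus d) :
    torusGradient u y = gradient (fun v => u (torusProj v)) (torusLift y) := by
  rw [torusGradient, gradient, gradient]
  congr 1
  have := fderiv_comp_add_left (𝕜 := ℝ) (f := fun v => u (torusProj v)) (x := 0) (torusLift y)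
  simpa only [torusProj_add, torusProj_torusLift, add_zero] using this

lemma measurable_torusGradient (u : Torus d → ℝ) : Measurable (torusGradient u) := by
  rw [funext (torusGradient_eq u)]
  exact (measurable_gradient _).comp measurable_torusLift

lemma measurable_torusProj : Measurable (torusProj : EuclideanSpace ℝ (Fin d) → Torus d) := by
  unfold torusProj
  refine measurable_pi_lambda _ fun i => ?_
  exact (AddCircle.measurable_mk' (a := 1)).comp (by fun_prop)

lemma differentiableAt_torus_iff {u : Torus d → ℝ} {v : EuclideanSpace ℝ (Fin d)} {y : Torus d}
    (h : torusProj v = y) : DifferentiableAt ℝ (fun w => u (y + torusProj w)) 0 ↔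
      DifferentiableAt ℝ (fun w => u (torusProj w)) v := by
  have := differentiableAt_comp_add_left (𝕜 := ℝ) (f := fun w => u (torusProj w)) (x := 0) v
  simpa only [torusProj_add, h, add_zero] using this

lemma ae_differentiableAt_torus {u : Torus d → ℝ}
    (hu : ∀ᵐ v, DifferentiableAt ℝ (fun w : EuclideanSpace ℝ (Fin d) => u (torusProj w)) v) :
    ∀ᵐ y, DifferentiableAt ℝ (fun w : EuclideanSpace ℝ (Fin d) => u (y + torusProj w)) 0 := by
  have hq := measurePreserving_pi (fun _ : Fin d => volume.restrict (Ioc (0 : ℝ) (0 + 1)))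
    (fun _ : Fin d => (volume : Measure UnitAddCircle)) fun _ => UnitAddCircle.measurePreserving_mk 0
  have hmeas : MeasurableSet {y : Torus d |
      DifferentiableAt ℝ (fun w : EuclideanSpace ℝ (Fin d) => u (y + torusProj w)) 0} := by
    simp only [fun y : Torus d => differentiableAt_torus_iff (u := u) (torusProj_torusLift y)]
    exact measurable_torusLift (measurableSet_of_differentiableAt ℝ _)
  -- Haar measure on the torus is the image of Lebesgue measure on the unit cube, so null sets
  -- transfer from `ℝᵈ`.
  rw [volume_pi, ← hq.map_eq, ae_map_iff hq.measurable.aemeasurable hmeas,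
    ← Measure.restrict_pi_pi]
  refine ae_restrict_of_ae ?_
  have := (PiLp.volume_preserving_toLp (Fin d)).quasiMeasurePreserving.ae hu
  filter_upwards [this] with a ha
  exact (differentiableAt_torus_iff rfl).2 ha

lemma ae_differentiableAt_legendre_torusPairing (θ : C(Torus d, ℝ)) :
    ∀ᵐ y, DifferentiableAt ℝ (fun w : EuclideanSpace ℝ (Fin d) =>
      legendre torusPairing θ (y + torusProj w)) 0 := by
  refine ae_differentiableAt_torus (LipschitzWith.ae_differentiableAt (C := d) ?_)
  refine LipschitzWith.of_dist_le_mul fun v v' => ?_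
  refine abs_legendre_sub_legendre_le_of_forall continuous_torusPairing θ fun x => ?_
  have hhalf (a : UnitAddCircle) : ‖a‖ ≤ 1 / 2 := by
    simpa using AddCircle.norm_le_half_period (p := 1) (x := a) one_ne_zero
  -- Factor `a² - b²`: circle norms are at most `1/2`, so `a + b ≤ 1`. Summing over coordinates
  -- gives the Lipschitz constant `d`.
  have key (i : Fin d) : |‖x i - torusProj v' i‖ ^ 2 - ‖x i - torusProj v i‖ ^ 2| ≤ dist v v' := by
    rw [sq_sub_sq, abs_mul]
    have h1 : |‖x i - torusProj v' i‖ + ‖x i - torusProj v i‖| ≤ 1 := by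
      rw [abs_of_nonneg (by positivity)]
      linarith [hhalf (x i - torusProj v' i), hhalf (x i - torusProj v i)]
    have h2 : |‖x i - torusProj v' i‖ - ‖x i - torusProj v i‖| ≤ dist v v' := by
      refine (abs_norm_sub_norm_le _ _).trans ?_
      have e : x i - torusProj v' i - (x i - torusProj v i)
          = ((v i - v' i : ℝ) : UnitAddCircle) := by
        simp [torusProj]
      rw [e, dist_eq_norm]
      exact (UnitAddCircle.norm_coe_le _).trans (PiLp.norm_apply_le (v - v') i)
    exact (mul_le_mul h1 h2 (abs_nonneg _) zero_le_one).trans_eq (one_mul _)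
  have e : torusPairing x (torusProj v) - torusPairing x (torusProj v')
      = ∑ i, (‖x i - torusProj v' i‖ ^ 2 - ‖x i - torusProj v i‖ ^ 2) := by
    rw [Finset.sum_sub_distrib, torusPairing, torusPairing]
    ring
  rw [e]
  refine (Finset.abs_sum_le_sum_abs _ _).trans ((Finset.sum_le_sum fun i _ => key i).trans_eq ?_)
  simp

lemma exists_torusProj_eq (z : Torus d) :
    ∃ w : EuclideanSpace ℝ (Fin d), torusProj w = z ∧ ∑ i, ‖z i‖ ^ 2 = ‖w‖ ^ 2 := by
  have h (i : Fin d) : ∃ r : ℝ, (r : UnitAddCircle) = z i ∧ ‖z i‖ = |r| := by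
    obtain ⟨r, hr⟩ := QuotientAddGroup.mk_surjective (z i)
    refine ⟨r - round r, ?_, ?_⟩
    · rw [← hr, AddCircle.coe_sub, sub_eq_self]
      exact (AddCircle.coe_eq_zero_iff 1).2 ⟨round r, by simp⟩
    · rw [← hr]
      exact UnitAddCircle.norm_eq
  choose r hr hr' using h
  refine ⟨WithLp.toLp 2 r, funext hr, ?_⟩
  simp [EuclideanSpace.norm_sq_eq, hr']

lemma eq_add_torusProj_of_legendre_eq {θ : C(Torus d, ℝ)} {y x : Torus d}
    (hy : DifferentiableAt ℝ (fun w : EuclideanSpace ℝ (Fin d) =>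
      legendre torusPairing θ (y + torusProj w)) 0)
    (hx : legendre torusPairing θ y = torusPairing x y - θ x) :
    x = y + torusProj ((1 / 2 : ℝ) • torusGradient (legendre torusPairing θ) y) := by
  obtain ⟨w, hw, hw'⟩ := exists_torusProj_eq (x - y)
  have hproj0 : torusProj (0 : EuclideanSpace ℝ (Fin d)) = 0 := by
    ext i
    simp [torusProj]
  have hgrad : torusGradient (legendre torusPairing θ) y = (2 : ℝ) • w := by
    -- The squared distance need not be smooth at the cut locus. With `w` a shortest lift of `x -
    -- y`, the smooth function `-‖w - v‖² - θ x` touches the transform from below at `v = 0`; its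
    -- gradient there is `2w`, whence the factor `1/2`.
    refine gradient_eq_of_touching (l := fun v => -‖w - v‖ ^ 2 - θ x) hy ?_ (fun v => ?_) ?_
    · have h := (((hasFDerivAt_id (𝕜 := ℝ) (0 : EuclideanSpace ℝ (Fin d))).const_sub
        w).norm_sq.neg).sub_const (θ x)
      rw [hasGradientAt_iff_hasFDerivAt]
      refine h.congr_fderiv ?_
      ext v
      simp
    · refine le_trans ?_ (sub_le_legendre continuous_torusPairing θ x _)
      refine sub_le_sub_right (neg_le_neg ?_) _
      rw [EuclideanSpace.norm_sq_eq]
      refine Finset.sum_le_sum fun i _ => pow_le_pow_left₀ (norm_nonneg _) ?_ 2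
      have e : x i - (y + torusProj v) i = ((w i - v i : ℝ) : UnitAddCircle) := by
        have := congrFun hw i
        simp only [torusProj, Pi.sub_apply] at this
        rw [AddCircle.coe_sub, this]
        simp only [torusProj, Pi.add_apply]
        abel
      rw [e]
      exact UnitAddCircle.norm_coe_le _
    · simp only [hproj0, add_zero, sub_zero, hx, torusPairing, ← hw', Pi.sub_apply]
  rw [hgrad, smul_smul]
  norm_num [hw]

lemma torusMap_spec {ν : Measure (Torus d)} (hν : ν ≪ volume) (θ : C(Torus d, ℝ)) :
    ∀ᵐ y ∂ν, ∀ x, legendre torusPairing θ y = torusPairing x y - θ x →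
      x = y + torusProj ((1 / 2 : ℝ) • torusGradient (legendre torusPairing θ) y) :=
  hν.ae_le ((ae_differentiableAt_legendre_torusPairing θ).mono fun _ hy _ hx =>
    eq_add_torusProj_of_legendre_eq hy hx)

lemma measurable_torusMap (u : Torus d → ℝ) :
    Measurable fun y => y + torusProj ((1 / 2 : ℝ) • torusGradient u y) :=
  measurable_id.add
    (measurable_torusProj.comp ((measurable_torusGradient u).const_smul (1 / 2 : ℝ)))

end Torus

end MAGibbs
theorem proposition7p8 (d : ℕ) (β : ℝ) (hβ : β ≠ 0) :
    -- Euclidean setting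
    (∀ (X Y : Set (EuclideanSpace ℝ (Fin d))), IsCompact X → IsCompact Y →
      ∀ (μ₀ : Measure X) [IsProbabilityMeasure μ₀] [μ₀.IsOpenPosMeasure]
        (ν : Measure (EuclideanSpace ℝ (Fin d))) [IsProbabilityMeasure ν],
        ν Yᶜ = 0 → ν ≪ volume →
        ((∃ φ, MAGibbs.IsUniqueMinimizerModConst
              (MAGibbs.F (MAGibbs.euclPairing X) β μ₀ ν) φ) ↔
            ∃! μ, MAGibbs.IsMinimizer (MAGibbs.G (MAGibbs.euclPairing X) β μ₀ ν) μ) ∧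
        ∀ φ, MAGibbs.IsUniqueMinimizerModConst (MAGibbs.F (MAGibbs.euclPairing X) β μ₀ ν) φ →
          (∀ μ, MAGibbs.IsMinimizer (MAGibbs.G (MAGibbs.euclPairing X) β μ₀ ν) μ →
            (μ : Measure X).map Subtype.val = MAGibbs.euclMA X ν φ) ∧
          MAGibbs.euclMA X ν φ = (μ₀.tilted (fun x => β * φ x)).map Subtype.val) ∧
    -- torus setting
    (∀ (μ₀ : Measure (MAGibbs.Torus d)) [IsProbabilityMeasure μ₀] [μ₀.IsOpenPosMeasure]
        (ν : Measure (MAGibbs.Torus d)) [IsProbabilityMeasure ν], ν ≪ volume →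
        ((∃ φ, MAGibbs.IsUniqueMinimizerModConst
              (MAGibbs.F MAGibbs.torusPairing β μ₀ ν) φ) ↔
            ∃! μ, MAGibbs.IsMinimizer (MAGibbs.G MAGibbs.torusPairing β μ₀ ν) μ) ∧
        ∀ φ, MAGibbs.IsUniqueMinimizerModConst (MAGibbs.F MAGibbs.torusPairing β μ₀ ν) φ →
          (∀ μ, MAGibbs.IsMinimizer (MAGibbs.G MAGibbs.torusPairing β μ₀ ν) μ →
            (μ : Measure (MAGibbs.Torus d)) = MAGibbs.torusMA ν φ) ∧
          MAGibbs.torusMA ν φ = μ₀.tilted (fun x => β * φ x)) := by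
  refine ⟨fun X Y hX hY μ₀ _ _ ν _ hνY hν => ?_, fun μ₀ _ _ ν _ hν => ?_⟩
  · have : CompactSpace X := isCompact_iff_compactSpace.1 hX
    have : Nonempty X := nonempty_of_isProbabilityMeasure μ₀
    have hp := MAGibbs.continuous_euclPairing (X := X)
    have hT : MAGibbs.IsTwisted (MAGibbs.euclPairing X) ν := fun θ => by
      obtain ⟨T, h1, h2, -⟩ := MAGibbs.exists_gradient_map hν θ
      exact ⟨T, h1, h2⟩
    refine ⟨MAGibbs.exists_isUniqueMinimizerModConst_iff μ₀ hp hY hνY hT hβ, fun φ hφ => ?_⟩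
    obtain ⟨T, h1, h2, h3⟩ := MAGibbs.exists_gradient_map hν φ
    have hMA : MAGibbs.euclMA X ν φ = (μ₀.tilted fun x => β * φ x).map Subtype.val := by
      rw [← h3, MAGibbs.tilted_eq_map μ₀ hp hY hνY hβ hφ.1 h1 h2]
    refine ⟨fun μ hμ => ?_, hMA⟩
    rw [hMA, MAGibbs.eq_gibbs_of_isUniqueMinimizerModConst μ₀ hp hY hνY hT hβ hφ hμ]
    rfl
  · have hp := MAGibbs.continuous_torusPairing (d := d)
    have hν0 : ν (univ : Set (MAGibbs.Torus d))ᶜ = 0 := by simp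
    have hT : MAGibbs.IsTwisted MAGibbs.torusPairing ν := fun θ =>
      ⟨_, MAGibbs.measurable_torusMap _, MAGibbs.torusMap_spec hν θ⟩
    refine ⟨MAGibbs.exists_isUniqueMinimizerModConst_iff μ₀ hp isCompact_univ hν0 hT hβ,
      fun φ hφ => ?_⟩
    have hMA := MAGibbs.tilted_eq_map μ₀ hp isCompact_univ hν0 hβ hφ.1
      (MAGibbs.measurable_torusMap _) (MAGibbs.torusMap_spec hν φ)
    refine ⟨fun μ hμ => ?_, hMA.symm⟩
    rw [MAGibbs.eq_gibbs_of_isUniqueMinimizerModConst μ₀ hp isCompact_univ hν0 hT hβ hφ hμ]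
    exact hMA
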